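/- Let $k$ be a commutative ring (with $1$), let $X$ be a set, and let $k\langle X\rangle$ be the free associative unital $k$-algebra on $X$. Let $W$ be a set of nonempty words in the elements of $X$ such that no member of $W$ is a subword (that is, a block of consecutive letters) of another member of $W$, and such that no nonempty proper final subword of a member of $W$ is also an initial subword of a member of $W$ (the same one or another). Then the unital $k$-subalgebra $A$ of $k\langle X\rangle$ generated by $W$ is free on $W$; that is, the $k$-algebra homomorphism $k\langle W\rangle\to A$ sending each free generator $w\in W$ to the corresponding monomial $w\in k\langle X\rangle$ is an isomorphism. Moreover, the inclusion $A\subseteq k\langle X\rangle$ has the ideal extension property: for every two-sided ideal $I$ of $A$ there is a two-sided ideal $J$ of $k\langle X\rangle$ with $I=A\cap J$. -/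

import Mathlib

universe u v w

/-- The element of the free associative unital algebra `k⟨X⟩` given by a word (a finite list of
letters) in `X`: the product of its letters in order. -/
def wordElem (k : Type u) [CommRing k] {X : Type v} (l : List X) : FreeAlgebra k X :=
  (l.map (FreeAlgebra.ι k)).prod

/-- The unital `k`-subalgebra of `k⟨X⟩` generated by a set `W` of words. -/
def wordSubalgebra (k : Type u) [CommRing k] {X : Type v} (W : Set (List X)) :
    Subalgebra k (FreeAlgebra k X) :=
  Algebra.adjoin k (wordElem k '' W)

/-- The members of `W`, as elements of the subalgebra that they generate. -/
def wordGen (k : Type u) [CommRing k] {X : Type v} (W : Set (List X)) (l : W) :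
    wordSubalgebra k W :=
  ⟨wordElem k l.1, Algebra.subset_adjoin (Set.mem_image_of_mem _ l.2)⟩

/-- The `k`-algebra `A` is free on the family `g`: the homomorphism to `A` from the free
associative unital algebra on the index type that sends each generator `i` to `g i` is an
isomorphism. -/
def IsFreeAlgebraOn (k : Type u) [CommRing k] {A : Type v} [Ring A] [Algebra k A]
    {ι : Type w} (g : ι → A) : Prop :=
  Function.Bijective (FreeAlgebra.lift k g)

/-- The subalgebra `A` of `B` has the ideal extension property in `B`: every two-sided ideal
of `A` is the intersection with `A` of a two-sided ideal of `B`. -/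
def HasIdealExtensionProperty {k : Type u} [CommRing k] {B : Type v} [Ring B] [Algebra k B]
    (A : Subalgebra k B) : Prop :=
  ∀ I : TwoSidedIdeal A, ∃ J : TwoSidedIdeal B, ∀ a : A, a ∈ I ↔ (a : B) ∈ J

/-! Any map `r : W → R` into a `k`-algebra gives an action of `k⟨X⟩` on functions `List X → R` under
which each `l ∈ W` acts as left multiplication by `r l` (`rewriteRep_wordElem`). Hence `A` acts
through the map induced by `r`, and applying the action to the constant function `1` recovers that
map. Taking `R = k⟨W⟩` gives freeness; taking `R = A/I`, the kernel of the action is the required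
`J`. -/

open scoped Classical in
/-- The functional `f ↦ f t`, except that when `t` ends in some `l ∈ W`, say `t = s ++ l`, it is
`f ↦ r l * f s`. -/
noncomputable def rewriteEval (k : Type u) [CommRing k] {X : Type v} {W : Set (List X)}
    {R : Type w} [Ring R] [Algebra k R] (r : W → R) (t : List X) : (List X → R) →ₗ[k] R :=
  if h : ∃ p : List X × W, p.1 ++ p.2.1 = t then
    LinearMap.mulLeft k (r h.choose.2) ∘ₗ LinearMap.proj h.choose.1
  else LinearMap.proj t

/-- The representation of `k⟨X⟩` on functions on words in which a letter `x` acts by appending `x`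
to the argument and then replacing a final subword `l ∈ W` by the scalar `r l`. -/
noncomputable def rewriteRep (k : Type u) [CommRing k] {X : Type v} {W : Set (List X)}
    {R : Type w} [Ring R] [Algebra k R] (r : W → R) :
    FreeAlgebra k X →ₐ[k] Module.End k (List X → R) :=
  FreeAlgebra.lift k fun x => LinearMap.pi fun t => rewriteEval k r (t ++ [x])

section

variable {k : Type u} [CommRing k] {X : Type v} {W : Set (List X)}
  {R : Type w} [Ring R] [Algebra k R] (r : W → R)

theorem rewriteEval_of_forall_not_suffix {t : List X} (h : ∀ l ∈ W, ¬ l <:+ t)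
    (f : List X → R) : rewriteEval k r t f = f t := by
  have h' : ¬ ∃ p : List X × W, p.1 ++ p.2.1 = t := fun ⟨p, hp⟩ => h p.2.1 p.2.2 ⟨p.1, hp⟩
  simp [rewriteEval, dif_neg h']

/-- Two suffixes of one word are comparable, so by `hsub` the suffix in `W` is unique and the choice
is forced. -/
theorem rewriteEval_append (hsub : ∀ l ∈ W, ∀ m ∈ W, l ≠ m → ¬ l <:+: m)
    (l : W) (t : List X) (f : List X → R) :
    rewriteEval k r (t ++ l.1) f = r l * f t := by
  have h : ∃ p : List X × W, p.1 ++ p.2.1 = t ++ l.1 := ⟨(t, l), rfl⟩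
  have huniq : ∀ p : List X × W, p.1 ++ p.2.1 = t ++ l.1 → p = (t, l) := by
    rintro ⟨s, m⟩ e
    have hml : m = l := by
      by_contra hne
      have hne' : m.1 ≠ l.1 := fun e => hne (Subtype.ext e)
      rcases List.suffix_or_suffix_of_suffix ⟨s, e⟩ (List.suffix_append t l.1) with h1 | h1
      · exact hsub _ m.2 _ l.2 hne' h1.isInfix
      · exact hsub _ l.2 _ m.2 hne'.symm h1.isInfix
    subst hml
    exact Prod.ext (List.append_cancel_right e) rfl
  rw [rewriteEval, dif_pos h, huniq _ h.choose_spec]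
  rfl

/-- No rewriting occurs while the letters of `l` are only partly appended: a suffix `m ∈ W` would
lie inside `l` or overlap it in `p`. -/
theorem not_suffix_append_of_prefix (hsub : ∀ l ∈ W, ∀ m ∈ W, l ≠ m → ¬ l <:+: m)
    (hoverlap : ∀ l ∈ W, ∀ m ∈ W, ∀ s : List X, s ≠ [] → s ≠ l → s <:+ l → ¬ s <+: m)
    {l p : List X} (hl : l ∈ W) (hp : p <+: l) (hp0 : p ≠ []) (hpl : p ≠ l) (t : List X) :
    ∀ m ∈ W, ¬ m <:+ t ++ p := by
  intro m hm hmt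
  rcases List.suffix_or_suffix_of_suffix hmt (List.suffix_append t p) with h | h
  · refine hsub m hm l hl ?_ (h.isInfix.trans hp.isInfix)
    rintro rfl
    exact hpl (hp.eq_of_length_le h.length_le)
  · by_cases e : p = m
    · subst e
      exact hsub p hm l hl hpl hp.isInfix
    · exact hoverlap m hm l hl p hp0 e h hp

@[simp]
theorem wordElem_cons (x : X) (l : List X) :
    wordElem k (x :: l) = FreeAlgebra.ι k x * wordElem k l := by
  simp [wordElem]

theorem rewriteRep_ι_mul (x : X) (a : FreeAlgebra k X) (f : List X → R) (t : List X) :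
    rewriteRep k r (FreeAlgebra.ι k x * a) f t =
      rewriteEval k r (t ++ [x]) (rewriteRep k r a f) := by
  simp [rewriteRep]

/-- Here `p` is the part of `l` already appended and `q` the part still to act; the rewriting
happens only at the last letter. -/
theorem rewriteRep_wordElem_append (hsub : ∀ l ∈ W, ∀ m ∈ W, l ≠ m → ¬ l <:+: m)
    (hoverlap : ∀ l ∈ W, ∀ m ∈ W, ∀ s : List X, s ≠ [] → s ≠ l → s <:+ l → ¬ s <+: m)
    (l : W) (f : List X → R) (t q : List X) (hq : q ≠ []) :
    ∀ p, p ++ q = l.1 → rewriteRep k r (wordElem k q) f (t ++ p) = r l * f t := by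
  induction q with
  | nil => exact absurd rfl hq
  | cons x q ih =>
    intro p hp
    rw [wordElem_cons, rewriteRep_ι_mul, List.append_assoc]
    rcases eq_or_ne q [] with rfl | hq'
    · rw [hp, rewriteEval_append r hsub]
      simp [wordElem]
    · have hp' : (p ++ [x]) ++ q = l.1 := by simpa using hp
      rw [rewriteEval_of_forall_not_suffix, ih hq' _ hp']
      refine not_suffix_append_of_prefix hsub hoverlap l.2 ⟨q, hp'⟩ (by simp) ?_ t
      intro e
      rw [e] at hp'
      exact hq' (by simpa using hp')

theorem rewriteRep_wordElem (hne : ∀ l ∈ W, l ≠ [])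
    (hsub : ∀ l ∈ W, ∀ m ∈ W, l ≠ m → ¬ l <:+: m)
    (hoverlap : ∀ l ∈ W, ∀ m ∈ W, ∀ s : List X, s ≠ [] → s ≠ l → s <:+ l → ¬ s <+: m)
    (l : W) (f : List X → R) (t : List X) :
    rewriteRep k r (wordElem k l.1) f t = r l * f t := by
  simpa using rewriteRep_wordElem_append (k := k) r hsub hoverlap l f t l.1 (hne _ l.2) [] rfl

/-- Every element of the subalgebra generated by `W` acts diagonally. -/
theorem rewriteRep_lift_wordGen (hne : ∀ l ∈ W, l ≠ [])
    (hsub : ∀ l ∈ W, ∀ m ∈ W, l ≠ m → ¬ l <:+: m)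
    (hoverlap : ∀ l ∈ W, ∀ m ∈ W, ∀ s : List X, s ≠ [] → s ≠ l → s <:+ l → ¬ s <+: m)
    (a : FreeAlgebra k W) (f : List X → R) (t : List X) :
    rewriteRep k r (FreeAlgebra.lift k (wordGen k W) a : wordSubalgebra k W) f t =
      FreeAlgebra.lift k r a * f t := by
  induction a using FreeAlgebra.induction generalizing f t with
  | grade0 c => simp [Algebra.smul_def]
  | grade1 l =>
    simpa [wordGen] using rewriteRep_wordElem (k := k) r hne hsub hoverlap l f t
  | mul a b ha hb => simp [ha, hb, mul_assoc]
  | add a b ha hb => simp [ha, hb, add_mul]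

end

theorem lift_wordGen_surjective (k : Type u) [CommRing k] {X : Type v} (W : Set (List X)) :
    Function.Surjective (FreeAlgebra.lift k (wordGen k W)) := by
  rintro ⟨a, ha⟩
  have hle : wordSubalgebra k W ≤
      ((wordSubalgebra k W).val.comp (FreeAlgebra.lift k (wordGen k W))).range := by
    refine Algebra.adjoin_le ?_
    rintro _ ⟨l, hl, rfl⟩
    exact ⟨FreeAlgebra.ι k ⟨l, hl⟩, by simp [wordGen]⟩
  obtain ⟨b, hb⟩ := hle ha
  exact ⟨b, Subtype.ext hb⟩

theorem corollaryC {k : Type u} [CommRing k] {X : Type v} (W : Set (List X))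
    (hne : ∀ l ∈ W, l ≠ [])
    (hsub : ∀ l ∈ W, ∀ m ∈ W, l ≠ m → ¬ l <:+: m)
    (hoverlap : ∀ l ∈ W, ∀ m ∈ W, ∀ s : List X,
      s ≠ [] → s ≠ l → s <:+ l → ¬ s <+: m) :
    IsFreeAlgebraOn k (wordGen k W) ∧
      HasIdealExtensionProperty (wordSubalgebra k W) := by
  refine ⟨⟨fun a b hab => ?_, lift_wordGen_surjective k W⟩, fun I => ?_⟩
  -- With `R = k⟨W⟩` and `r` the inclusion of generators, the scalar by which `a` acts is `a`
  -- itself.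
  · have key := rewriteRep_lift_wordGen (k := k) (FreeAlgebra.ι k : W → _) hne hsub hoverlap
    have ha := key a 1 []
    have hb := key b 1 []
    rw [hab, hb] at ha
    have hid : FreeAlgebra.lift k (FreeAlgebra.ι k : W → _) = AlgHom.id k _ :=
      FreeAlgebra.hom_ext (by ext; simp)
    simpa [hid] using ha.symm
  · let π : wordSubalgebra k W →ₐ[k] I.ringCon.Quotient :=
      { I.ringCon.mk' with commutes' := fun _ => rfl }
    have hπ (a) : a ∈ I ↔ π a = 0 := by
      rw [TwoSidedIdeal.mem_iff]
      exact (RingCon.eq I.ringCon).symm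
    let ρ := rewriteRep k (fun l : W => π (wordGen k W l))
    have hρ (a : wordSubalgebra k W) (f t) : ρ a f t = π a * f t := by
      obtain ⟨b, rfl⟩ := lift_wordGen_surjective k W a
      rw [rewriteRep_lift_wordGen _ hne hsub hoverlap]
      congr 1
      exact DFunLike.congr_fun (FreeAlgebra.hom_ext (by ext; simp) :
        FreeAlgebra.lift k _ = π.comp (FreeAlgebra.lift k (wordGen k W))) b
    -- By `hρ`, `a` acts as zero exactly when `π a = 0`.
    refine ⟨TwoSidedIdeal.ker ρ, fun a => ?_⟩
    rw [hπ, TwoSidedIdeal.mem_ker]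
    constructor
    · intro h
      ext f t
      rw [hρ, h, zero_mul]
      rfl
    · intro h
      have := hρ a 1 []
      rw [h] at this
      simpa using this.symm
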